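/- **Theorem (Transmission Correctness).** *Clocks and registers.* A sender $s$ and a receiver $r$ have clock periods $\tau_s,\tau_r>0$; rising edge number $c$ of unit $u$ occurs at time $e_u(c)=c\,\tau_u$. Signals map time to $\{0,1,\Omega\}$ ($\Omega$ = undefined voltage). Registers have set-up time $t_s\ge 0$, holding time $t_h\ge 0$ and propagation delays $0\le t_{p\min}\le t_{p\max}$ with $t_s+t_h+t_{p\min}+t_{p\max}<\tau_u$ for $u=s,r$. The analog register of unit $u$ with control signal $ce$, input signal $in$ and initial output bit $o$ outputs the following during its cycle $]e_u(c):e_u(c+1)]$. For $c=0$ it outputs $o$. For $c\ge1$, let $y$ be its value at time $e_u(c)$ in cycle $c-1$. If $ce$ and $in$ are both constant and in $\{0,1\}$ on $[e_u(c)-t_s,e_u(c)+t_h]$ and $ce(e_u(c))=1$, it outputs $y$ on $e_u(c)+]0:t_{p\min}]$, $\Omega$ on $e_u(c)+]t_{p\min}:t_{p\max}]$, and $in(e_u(c))$ on $e_u(c)+]t_{p\max}:\tau_u]$. If they are both so and $ce(e_u(c))=0$, it outputs $y$ throughout. Otherwise (metastability) it outputs $y$ on $e_u(c)+]0:t_{p\min}]$,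 then $\Omega$, and an arbitrary bit during $[e_u(c+1)-t_s:e_u(c+1)]$. *Mark.* Receiver edge $\xi$ is the mark of sender cycle $c$, written $mk(\xi,c)$, if $e_s(c)+t_{p\min}<e_r(\xi)+t_h\le e_s(c)+t_{p\min}+\tau_r$, that is, if $\xi$ is the first receiver edge affected by sender edge $c$. *Hypotheses on the link.* For a reference period $\tau_{ref}>0$ and a number $\delta$, $1-\delta\le\tau_u/\tau_{ref}\le1+\delta$ for $u=s,r$, and the drift bound $\pi=\frac{1-\delta}{2\delta}$ satisfies $\pi\ge80$ (in particular $6+1\le7\le\pi$). The bit sequences $ce_s,in_s$ feed the sender's analog register through signals which equal the bit with index $m$ during $[e_s(m+1)-t_s,e_s(m+1)+t_h]$. The input of the receiver's analog register, whose control signal is constantly 1, is the output of the sender's analog register. The receiver hardware reads in each cycle $t$ the bit $inp^t$ that the receiver's analog register outputs at time $e_r(t+1)$ at the end of cycle $t$. Let $out_s^m$ be the content of the sender's digital output register after edge $m$: $out_s^0$ is its initial bit, and $out_s^{m+1}$ is $in_s[m]$ if $ce_s[m]=1$, and $out_s^m$ otherwise. *Hypotheses on the sender.* A frame with $l$ bytes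 is sent from sender cycle $c>0$ on, and $mk(\xi,c)$ holds. For each of the frame's first $10l+2$ bits $i=0,\dots,10l+1$: $ce_s[c+8i-1]=1$ and $ce_s[c+8i+j-1]=0$ for $1\le j\le7$. The frame starts with a zero: $out_s^{c+y}=0$ for $0\le y\le7$. Before each byte $i<l$ it contains the byte start sequence $BSS[0]=1$, $BSS[1]=0$: $out_s^{c+80i+16+y}=1$ and $out_s^{c+80i+24+y}=0$ for $0\le y\le7$. *Receiver.* In each cycle $inp$ is shifted into a chain of six one-bit registers (two synchronizer registers and a 4-bit shift register); the voted bit $v^t$ is the majority of the last five of them. With control state $z$ and a 3-bit counter $cnt$: $sync^t$ holds iff $v^t\ne v^{t-1}$ and $z^t\in\{BSS[1],idle\}$; $cnt^{t+1}=000$ if $sync^t$, and $cnt^{t+1}=cnt^t+1$ (mod 8) otherwise; $strobe^t$ holds iff $cnt^t=010$ and not $sync^t$. On each strobe $v$ is shifted into the 8-bit register BYTE (so that after eight strobes BYTE[$j$] is the bit strobed at the $(j+1)$-st of them), and $z$ moves: from $idle$ to $FSS$ if $v=0$ (it stays $idle$ if $v=1$), then $FSS\to BSS[0]\to BSS[1]\to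 b[0]\to\dots\to b[7]$, from $b[7]$ to $BSS[0]$ if this is not yet the $l$-th byte of the message and to $FES[0]$ otherwise, $FES[0]\to FES[1]\to idle$. Its initial state is arbitrary, but at cycle $\xi$ it is idle: $z^\xi=idle$, the six one-bit registers all hold the idle bus value 1, and $v^{\xi-1}=1$. *Conclusion.* For every byte $i<l$ there is a receiver cycle $\nu$ such that $mk(\nu,c+16+80i)$ ($\nu$ is the $BSS[0]$-mark of byte $i$) and at least one of the following four cases holds, where $\mu$ denotes a receiver cycle with $mk(\mu,c+24+80i)$ (the $BSS[1]$-mark) and $R(t)$ abbreviates: $z^t=b[7]$, $cnt^t=010$, and $\mathrm{BYTE}^{t+1}[j]=out_s^{c+16+80i+8(j+2)}$ for all $j=0,\dots,7$: 1. $\mu=\nu+7$ and $R(\nu+78)$; 2. $\mu\in\{\nu+7,\nu+8\}$ and $R(\nu+79)$; 3. $\mu\in\{\nu+8,\nu+9\}$ and $R(\nu+80)$; 4. $\mu=\nu+9$ and $R(\nu+81)$. So each byte is in the BYTE register 79 to 82 receiver cycles after its $BSS[0]$-mark. -/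

import Mathlib

namespace FlexRay

/-! ### Signals, clocks, timing parameters -/

/-- The three signal values: logical low, logical high, and any other voltage. -/
inductive Level where
  | low
  | high
  | undef
deriving DecidableEq

/-- The defined level of a bit. -/
def Level.ofBit : Bool → Level
  | false => Level.low
  | true => Level.high

/-- A signal is a function of real time (only nonnegative times matter). -/
abbrev Signal := ℝ → Level

/-- Time of the rising edge number `c` of a clock of period `τ`. -/
def edge (τ : ℝ) (c : ℕ) : ℝ := (c : ℝ) * τ

/-- Set-up time, holding time, minimum and maximum propagation delay of a register. -/
structure Timing where
  ts : ℝ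
  th : ℝ
  tpmin : ℝ
  tpmax : ℝ

/-- The timing parameters are nonnegative durations, the minimum delay does not exceed the maximum
delay, and, measured as fractions of the clock period `τ`, their sum is less than one. -/
def Timing.Valid (T : Timing) (τ : ℝ) : Prop :=
  0 ≤ T.ts ∧ 0 ≤ T.th ∧ 0 ≤ T.tpmin ∧ T.tpmin ≤ T.tpmax ∧
    T.ts + T.th + T.tpmin + T.tpmax < τ

/-- Bounded clock jitter: the period `τ` deviates from the reference period by at most the
fraction `δ`. -/
def BoundedJitter (δ τref τ : ℝ) : Prop :=
  1 - δ ≤ τ / τref ∧ τ / τref ≤ 1 + δ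

/-- The bound on the clock drift, in clock cycles. -/
noncomputable def driftBound (δ : ℝ) : ℝ := (1 - δ) / (2 * δ)

/-! ### Analog registers -/

/-- The signal is stable and defined during the closed interval `[t₁ : t₂]`. -/
def Stadep (t₁ t₂ : ℝ) (s : Signal) : Prop :=
  ∃ b : Bool, ∀ t ∈ Set.Icc t₁ t₂, s t = Level.ofBit b

open Classical in
/-- Output of the analog register of a unit with clock period `τ` during its cycle `c`, as a signal
that is meaningful on `]edge τ c : edge τ (c + 1)]`.  The sequence `res` holds the (arbitrary)
bits to which metastable states resolve, one for each cycle. -/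
noncomputable def analogReg (T : Timing) (τ : ℝ) (ce inp : Signal) (out₀ : Bool) (res : ℕ → Bool) :
    ℕ → Signal
  | 0 => fun _ => Level.ofBit out₀
  | c + 1 =>
    let e := edge τ (c + 1)
    let old := analogReg T τ ce inp out₀ res c e
    if Stadep (e - T.ts) (e + T.th) ce ∧ Stadep (e - T.ts) (e + T.th) inp then
      if ce e = Level.high then
        fun t =>
          if t ∈ Set.Ioc e (e + T.tpmin) then old
          else if t ∈ Set.Ioc (e + T.tpmin) (e + T.tpmax) then Level.undef
          else if t ∈ Set.Ioc (e + T.tpmax) (e + τ) then inp e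
          else Level.undef
      else
        fun t => if t ∈ Set.Ioc e (e + τ) then old else Level.undef
    else
      fun t =>
        if t ∈ Set.Ioc e (e + T.tpmin) then old
        else if t ∈ Set.Ioo (e + T.tpmin) (e + τ - T.ts) then Level.undef
        else if t ∈ Set.Icc (e + τ - T.ts) (e + τ) then Level.ofBit (res (c + 1))
        else Level.undef

/-! ### Between bits and signals -/

/-- `Digitizes s t b`: the bit `b` is a possible result of converting the value of the signal `s` at
time `t`; a defined value is returned as it is, an undefined one gives an arbitrary bit. -/
def Digitizes (s : Signal) (t : ℝ) (b : Bool) : Prop :=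
  match s t with
  | Level.low => b = false
  | Level.high => b = true
  | Level.undef => True

/-- The signal `γ x` shows the bit with index `i` of the bit sequence `x` during the whole
metastability window around edge `i + 1` of the clock of period `τ`. -/
def Bv2sp (T : Timing) (τ : ℝ) (γ : (ℕ → Bool) → Signal) (x : ℕ → Bool) : Prop :=
  ∀ (i : ℕ) (t : ℝ), t ∈ Set.Icc (edge τ (i + 1) - T.ts) (edge τ (i + 1) + T.th) →
    γ x t = Level.ofBit (x i)

/-! ### The connection of a sender with a receiver -/

/-- The raw data of the connection of a sender `s` with a receiver `r`. -/
structure Link where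
  /-- jitter bound -/
  δ : ℝ
  /-- reference clock period, sender clock period, receiver clock period -/
  τref : ℝ
  τs : ℝ
  τr : ℝ
  timing : Timing
  /-- conversion of bit sequences to signals -/
  γ : (ℕ → Bool) → Signal
  /-- control bits and input bits of the sender output register; the entry with index `m` is
  clocked in at sender edge `m + 1` -/
  ceS : ℕ → Bool
  inS : ℕ → Bool
  /-- initial outputs and metastability resolutions of the two analog registers -/
  outS₀ : Bool
  outR₀ : Bool
  resS : ℕ → Bool
  resR : ℕ → Bool
  /-- input signal and control signal of the receiver input register -/
  inR : Signal
  ceR : Signal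

namespace Link

/-- Standing assumptions: positive periods, sensible timing parameters. -/
def WellFormed (L : Link) : Prop :=
  0 < L.τref ∧ 0 < L.τs ∧ 0 < L.τr ∧ L.timing.Valid L.τs ∧ L.timing.Valid L.τr

/-- The analog output register of the sender. -/
noncomputable def regS (L : Link) : ℕ → Signal :=
  analogReg L.timing L.τs (L.γ L.ceS) (L.γ L.inS) L.outS₀ L.resS

/-- The analog input register of the receiver. -/
noncomputable def regR (L : Link) : ℕ → Signal :=
  analogReg L.timing L.τr L.ceR L.inR L.outR₀ L.resR

/-- The bit which the sender puts on the bus in its cycle `m`: the content of its digital output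
register after sender edge `m`. -/
def outS (L : Link) : ℕ → Bool
  | 0 => L.outS₀
  | m + 1 => if L.ceS m then L.inS m else outS L m

/-- `L.Mark ξ c`: receiver edge `ξ` is the first one affected by what the sender does at its
edge `c`. -/
def Mark (L : Link) (ξ c : ℕ) : Prop :=
  edge L.τr ξ + L.timing.th ∈
    Set.Ioc (edge L.τs c + L.timing.tpmin) (edge L.τs c + L.timing.tpmin + L.τr)

/-- The analog and digital hypotheses on the connection. -/
def HypH (L : Link) (k n ξ c : ℕ) : Prop :=
  -- bounded drift, mark
  (BoundedJitter L.δ L.τref L.τr ∧ BoundedJitter L.δ L.τref L.τs ∧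
    n + 1 ≤ k ∧ (k : ℝ) ≤ driftBound L.δ ∧ L.Mark ξ c) ∧
  -- link: the receiver reads the output of the sender register, and its own register is enabled
  ((∀ m : ℕ, ∀ t ∈ Set.Ioc (edge L.τs m) (edge L.τs (m + 1)), L.inR t = L.regS m t) ∧
    ∀ t, L.ceR t = Level.high) ∧
  -- conversion of bits to signals
  (Bv2sp L.timing L.τs L.γ L.ceS ∧ Bv2sp L.timing L.τs L.γ L.inS) ∧
  -- sender
  (0 < c ∧ L.ceS (c - 1) = true ∧ ∀ j ∈ Finset.Icc 1 k, L.ceS (c + j - 1) = false)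

/-- The digitization link: the input bit of the receiver at hardware cycle `t` is the digitized
output of the analog register at receiver edge `t + 1`. -/
def MixAD (L : Link) (inp : ℕ → Bool) : Prop :=
  ∀ t : ℕ, Digitizes (L.regR t) (edge L.τr (t + 1)) (inp t)

end Link

/-! ### Sender correctness -/

/-- Each of the `N` bits sent from sender cycle `c` on is clocked into the output register once and
then held for `k` cycles. -/
def WFce (ce : ℕ → Bool) (N k c : ℕ) : Prop :=
  ∀ i < N, ce (c + 8 * i - 1) = true ∧ ∀ j ∈ Finset.Icc 1 k, ce (c + 8 * i + j - 1) = false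

/-- The byte start sequences (a one, then a zero) of the `l` bytes of the frame that starts at
cycle `c`. -/
def WFIn (out : ℕ → Bool) (l c : ℕ) : Prop :=
  ∀ i < l, ∀ y ∈ Finset.Icc 0 7,
    out (c + 80 * i + 16 + y) = true ∧ out (c + 80 * i + 24 + y) = false

/-- The transmission start sequence (a zero) of the frame that starts at cycle `c`. -/
def WFTss (out : ℕ → Bool) (c : ℕ) : Prop :=
  ∀ y ∈ Finset.Icc 0 7, out (c + y) = false

/-! ### The receiver hardware -/

/-- States of the control automaton.  The transmission start bit is read in state `idle`. -/
inductive CtrlState where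
  | idle
  | fss
  | bss0
  | bss1
  | b (j : Fin 8)
  | fes0
  | fes1
deriving DecidableEq

/-- State of the receiver. -/
structure Recv where
  /-- the two synchronizer registers -/
  R : Bool
  RH : Bool
  /-- the shift register of the majority vote, most recent bit first -/
  SH4 : Fin 4 → Bool
  /-- the voted bit of the previous cycle -/
  vOld : Bool
  /-- control automaton -/
  z : CtrlState
  /-- three-bit counter -/
  cnt : BitVec 3
  /-- shift register for the received byte -/
  BYTE : Fin 8 → Bool
  /-- number of complete bytes of the current message received so far -/
  nb : ℕ

namespace Recv

/-- Five-bit majority vote. -/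
def v (s : Recv) : Bool :=
  decide (3 ≤ s.RH.toNat + (s.SH4 0).toNat + (s.SH4 1).toNat + (s.SH4 2).toNat + (s.SH4 3).toNat)

/-- Synchronization signal. -/
def sync (s : Recv) : Bool :=
  decide (s.v ≠ s.vOld ∧ (s.z = CtrlState.bss1 ∨ s.z = CtrlState.idle))

/-- Strobe signal. -/
def strobe (s : Recv) : Bool :=
  decide (s.cnt = 0b010#3 ∧ s.sync = false)

/-- The write enable signal of the receive buffer: a complete byte has been received. -/
def we (s : Recv) : Bool :=
  decide (s.z = CtrlState.b 7 ∧ s.strobe = true)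

/-- The next control state on a strobe, for messages of `l` bytes: the idle state is left when a zero
is strobed, and the last byte is followed by the frame end sequence. -/
def nextCtrl (l : ℕ) (s : Recv) : CtrlState :=
  match s.z with
  | CtrlState.idle => if s.v then CtrlState.idle else CtrlState.fss
  | CtrlState.fss => CtrlState.bss0
  | CtrlState.bss0 => CtrlState.bss1
  | CtrlState.bss1 => CtrlState.b 0
  | CtrlState.b j =>
    if j = 7 then (if s.nb + 1 < l then CtrlState.bss0 else CtrlState.fes0)
    else CtrlState.b (j + 1)
  | CtrlState.fes0 => CtrlState.fes1
  | CtrlState.fes1 => CtrlState.idle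

/-- One hardware cycle of the receiver of messages of `l` bytes with input bit `inp`. -/
def step (l : ℕ) (inp : Bool) (s : Recv) : Recv where
  R := inp
  RH := s.R
  SH4 := fun j => if j = 0 then s.RH else s.SH4 (j - 1)
  vOld := s.v
  z := if s.strobe then s.nextCtrl l else s.z
  cnt := if s.sync then 0b000#3 else s.cnt + 1
  BYTE := if s.strobe then (fun j => if j = 7 then s.v else s.BYTE (j + 1)) else s.BYTE
  nb := if s.z = CtrlState.idle then 0 else if s.we then s.nb + 1 else s.nb

/-- The receiver is idle: the control automaton is in state `idle`, and the input stage has been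
reading the idle bus value one. -/
def Idle (s : Recv) : Prop :=
  s.z = CtrlState.idle ∧
    s.R = true ∧ s.RH = true ∧ (∀ j, s.SH4 j = true) ∧ s.vOld = true

end Recv

/-- `r` is a run of the receiver of messages of `l` bytes on the input sequence `inp`, from an
arbitrary initial state. -/
def IsRun (l : ℕ) (inp : ℕ → Bool) (r : ℕ → Recv) : Prop :=
  ∀ t : ℕ, r (t + 1) = Recv.step l (inp t) (r t)

/-- At receiver cycle `t` the last bit of a byte is being strobed, and one cycle later the byte
register holds the byte `x`. -/
def ByteReceived (r : ℕ → Recv) (t : ℕ) (x : Fin 8 → Bool) : Prop :=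
  (r t).z = CtrlState.b 7 ∧ (r t).cnt = 0b010#3 ∧ (r (t + 1)).BYTE = x

end FlexRay

open FlexRay

/-!
The sender holds every bit for eight of its cycles, and the inputs of its output register are stable
around every edge. So the bus shows a bit without interruption from the maximal propagation delay
after its first edge to the minimal propagation delay after the first edge of the next bit
(`Link.inR_eq`). In terms of marks, the receiver reads the bit correctly at all its edges strictly
between the mark `p` of the bit and the mark `q` of the next one (`Link.inp_eq`). Only the value read
at the mark itself is uncertain. Three of the five bits of a majority vote then suffice to make the
voted bit correct from cycle `p + 5` to cycle `q + 3` (`v_eq_of_const`).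

A drift bound of at least 80 means that over `n ≤ 80` cycles the distance of two marks is `n - 1`, `n`
or `n + 1` (`Link.Mark.dist`). Let `μ` be the mark of the second bit of a byte start sequence. The
receiver sees the falling edge of the voted bit, and resets its counter, in a cycle `s` that is `μ + 4`
or `μ + 5`; the ambiguity comes from the value read at `μ`. From then on it strobes in the cycles
`s + 3 + 8 k`, and for `1 ≤ k ≤ 8` such a cycle lies in the range where the voted bit is the `k`-th bit
of the byte, even if the drift has moved the marks by one cycle. The byte is complete in cycle
`s + 67`, that is, `μ + 71` or `μ + 72`, and the three possible distances of `μ` from the mark of the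
first bit of the byte start sequence give the four cases of the conclusion.

That the receiver is in state `bss1` in time for this synchronization is an induction over the bytes.
Its invariant is that `bss1` is entered between `μ - 1` and `μ + 2`: late enough for the voted bit to be
one already, early enough for it not to have fallen yet, and such that the falling edge comes before
the next strobe. For the first byte this follows from the synchronization to the transmission start
bit (`bss1_of_idle`), for later bytes from the synchronization in the previous byte, 80 sender cycles
earlier (`b_zero_of_bss1`, `byte_received`).
-/

namespace FlexRay

/-! ### Clock drift and marks -/

/-- A drift bound of at least 80 cycles makes two clocks that both respect the jitter bound diverge
by at most one receiver period within 80 cycles. -/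
theorem drift_le {δ τref τs τr : ℝ} (href : 0 < τref) (hπ : (80 : ℝ) ≤ driftBound δ)
    (hs : BoundedJitter δ τref τs) (hr : BoundedJitter δ τref τr) :
    80 * (τs - τr) ≤ τr ∧ 80 * (τr - τs) ≤ τr := by
  -- for `δ ≤ 0` the quotient in `driftBound` is at most `0` (at `δ = 0` by convention)
  have hδ : 0 < δ := by
    by_contra h
    have : driftBound δ ≤ 0 := div_nonpos_of_nonneg_of_nonpos (by linarith) (by linarith)
    linarith
  rw [driftBound, le_div_iff₀ (by linarith)] at hπ
  obtain ⟨hs1, hs2⟩ := hs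
  obtain ⟨hr1, hr2⟩ := hr
  rw [le_div_iff₀ href] at hs1 hr1
  rw [div_le_iff₀ href] at hs2 hr2
  have := mul_le_mul_of_nonneg_right hπ href.le
  constructor <;> linarith

theorem edge_succ (τ : ℝ) (c : ℕ) : edge τ (c + 1) = edge τ c + τ := by
  simp only [edge]; push_cast; ring

theorem edge_mono {τ : ℝ} (hτ : 0 ≤ τ) {a b : ℕ} (h : a ≤ b) : edge τ a ≤ edge τ b :=
  mul_le_mul_of_nonneg_right (by exact_mod_cast h) hτ

theorem lt_of_edge_lt {τ : ℝ} (hτ : 0 ≤ τ) {a b : ℕ} (h : edge τ a < edge τ b) : a < b := by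
  by_contra hab
  exact absurd (edge_mono hτ (not_lt.mp hab)) (not_le.mpr h)

/-- Every positive time lies in a cycle `]edge τ m : edge τ (m + 1)]`. -/
theorem exists_cycle {τ t : ℝ} (hτ : 0 < τ) (ht : 0 < t) :
    ∃ m : ℕ, t ∈ Set.Ioc (edge τ m) (edge τ (m + 1)) := by
  classical
  have hex : ∃ n : ℕ, t ≤ edge τ n := by
    obtain ⟨n, hn⟩ := exists_nat_ge (t / τ)
    exact ⟨n, (div_le_iff₀ hτ).mp hn⟩
  rcases h : Nat.find hex with _ | m
  · have := Nat.find_spec hex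
    rw [h] at this
    simp only [edge, Nat.cast_zero, zero_mul] at this
    linarith
  · refine ⟨m, not_le.mp (Nat.find_min hex (by omega)), ?_⟩
    have := Nat.find_spec hex
    rwa [h] at this

namespace Link

variable {L : Link}

theorem Mark.pos {ξ c : ℕ} (hL : L.WellFormed) (hc : 0 < c) (h : L.Mark ξ c) : 0 < ξ := by
  obtain ⟨_, hs, hr, hv, _⟩ := hL
  obtain ⟨h1, h2, h3, h4, h5⟩ := hv
  rcases Nat.eq_zero_or_pos ξ with rfl | h0
  · have := edge_mono hs.le (Nat.succ_le_of_lt hc)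
    have h' := h.1
    simp only [edge, Nat.cast_zero, zero_mul, Nat.cast_one, one_mul, Nat.succ_eq_add_one,
      zero_add] at this h'
    linarith
  · exact h0

/-- Once one sender cycle has a mark, so do all later ones. -/
theorem Mark.exists_later {ξ c : ℕ} (hL : L.WellFormed) (h : L.Mark ξ c) (n : ℕ) :
    ∃ ξ', L.Mark ξ' (c + n) := by
  classical
  obtain ⟨_, hs, hr, hv, _⟩ := hL
  have hex : ∃ k : ℕ, edge L.τs (c + n) + L.timing.tpmin - L.timing.th < edge L.τr k := by
    obtain ⟨k, hk⟩ := exists_nat_gt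
      ((edge L.τs (c + n) + L.timing.tpmin - L.timing.th) / L.τr)
    exact ⟨k, (div_lt_iff₀ hr).mp hk⟩
  refine ⟨Nat.find hex, ?_, ?_⟩
  · linarith [Nat.find_spec hex]
  · rcases hk : Nat.find hex with _ | k
    · have h1 := h.2
      have h2 := edge_mono hs.le (Nat.le_add_right c n)
      have h3 := edge_mono hr.le (Nat.zero_le ξ)
      linarith
    · have := Nat.find_min hex (m := k) (by omega)
      rw [edge_succ]
      linarith

/-- Within 80 cycles the distance of two marks differs by at most one from the distance of the
marked sender cycles. -/
theorem Mark.dist {a n p q : ℕ} (hr : 0 < L.τr)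
    (hd : 80 * (L.τs - L.τr) ≤ L.τr ∧ 80 * (L.τr - L.τs) ≤ L.τr) (hn : n ≤ 80)
    (hp : L.Mark p a) (hq : L.Mark q (a + n)) : p + n ≤ q + 1 ∧ q ≤ p + n + 1 := by
  obtain ⟨hp1, hp2⟩ := hp
  obtain ⟨hq1, hq2⟩ := hq
  have hn' : (n : ℝ) ≤ 80 := by exact_mod_cast hn
  have hn0 : (0 : ℝ) ≤ n := n.cast_nonneg
  have b1 : (n : ℝ) * (L.τs - L.τr) ≤ L.τr := by
    rcases le_total 0 (L.τs - L.τr) with h | h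
    · exact (mul_le_mul_of_nonneg_right hn' h).trans hd.1
    · exact (mul_nonpos_of_nonneg_of_nonpos hn0 h).trans hr.le
  have b2 : (n : ℝ) * (L.τr - L.τs) ≤ L.τr := by
    rcases le_total 0 (L.τr - L.τs) with h | h
    · exact (mul_le_mul_of_nonneg_right hn' h).trans hd.2
    · exact (mul_nonpos_of_nonneg_of_nonpos hn0 h).trans hr.le
  simp only [edge] at hp1 hp2 hq1 hq2
  push_cast at hp1 hp2 hq1 hq2
  constructor
  · have : ((p + n : ℕ) : ℝ) < ((q + 2 : ℕ) : ℝ) := by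
      push_cast
      refine lt_of_mul_lt_mul_right ?_ hr.le
      linarith
    have := Nat.cast_lt.mp this
    omega
  · have : (q : ℝ) < ((p + n + 2 : ℕ) : ℝ) := by
      push_cast
      refine lt_of_mul_lt_mul_right ?_ hr.le
      linarith
    have := Nat.cast_lt.mp this
    omega

/-! ### The sender register and the bus -/

/-- What the sender register outputs in the cycle after edge `m + 1`. Metastability is excluded,
because both of its inputs are stable around every edge. -/
theorem regS_succ (hs : Bv2sp L.timing L.τs L.γ L.ceS) (hi : Bv2sp L.timing L.τs L.γ L.inS)
    (hv : L.timing.Valid L.τs) (m : ℕ) :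
    L.regS (m + 1) =
      if L.ceS m then
        fun t =>
          if t ∈ Set.Ioc (edge L.τs (m + 1)) (edge L.τs (m + 1) + L.timing.tpmin) then
            L.regS m (edge L.τs (m + 1))
          else if t ∈ Set.Ioc (edge L.τs (m + 1) + L.timing.tpmin)
              (edge L.τs (m + 1) + L.timing.tpmax) then Level.undef
          else if t ∈ Set.Ioc (edge L.τs (m + 1) + L.timing.tpmax)
              (edge L.τs (m + 1) + L.τs) then Level.ofBit (L.inS m)
          else Level.undef
      else
        fun t => if t ∈ Set.Ioc (edge L.τs (m + 1)) (edge L.τs (m + 1) + L.τs) then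
          L.regS m (edge L.τs (m + 1)) else Level.undef := by
  obtain ⟨h1, h2, -⟩ := hv
  have hmem : edge L.τs (m + 1) ∈
      Set.Icc (edge L.τs (m + 1) - L.timing.ts) (edge L.τs (m + 1) + L.timing.th) :=
    ⟨by linarith, by linarith⟩
  have hce := hs m _ hmem
  have hin := hi m _ hmem
  have hst : Stadep (edge L.τs (m + 1) - L.timing.ts) (edge L.τs (m + 1) + L.timing.th)
      (L.γ L.ceS) ∧ Stadep (edge L.τs (m + 1) - L.timing.ts) (edge L.τs (m + 1) + L.timing.th)
      (L.γ L.inS) := ⟨⟨_, hs m⟩, ⟨_, hi m⟩⟩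
  simp only [regS, analogReg]
  rw [if_pos hst, hce, hin]
  cases L.ceS m <;> simp [Level.ofBit]

/-- After the maximal propagation delay the sender register shows the digital content. -/
theorem regS_new (hs : Bv2sp L.timing L.τs L.γ L.ceS) (hi : Bv2sp L.timing L.τs L.γ L.inS)
    (hv : L.timing.Valid L.τs) (m : ℕ) :
    ∀ t ∈ Set.Ioc (edge L.τs m + L.timing.tpmax) (edge L.τs (m + 1)),
      L.regS m t = Level.ofBit (L.outS m) := by
  have hv' := hv
  obtain ⟨h1, h2, h3, h4, h5⟩ := hv
  induction m with
  | zero => intro t _; simp [regS, analogReg, outS]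
  | succ m ih =>
    intro t ht
    rw [edge_succ L.τs (m + 1)] at ht
    have hold : L.regS m (edge L.τs (m + 1)) = Level.ofBit (L.outS m) :=
      ih _ ⟨by rw [edge_succ]; linarith, le_rfl⟩
    rw [regS_succ hs hi hv', outS, hold]
    cases L.ceS m
    · have : t ∈ Set.Ioc (edge L.τs (m + 1)) (edge L.τs (m + 1) + L.τs) :=
        ⟨by linarith [ht.1], ht.2⟩
      simp [this]
    · have n1 : t ∉ Set.Ioc (edge L.τs (m + 1)) (edge L.τs (m + 1) + L.timing.tpmin) :=
        fun h => by linarith [ht.1, h.2]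
      have n2 : t ∉ Set.Ioc (edge L.τs (m + 1) + L.timing.tpmin)
          (edge L.τs (m + 1) + L.timing.tpmax) := fun h => by linarith [ht.1, h.2]
      simp only [if_true, if_neg n1, if_neg n2, if_pos ht]

theorem regS_edge (hs : Bv2sp L.timing L.τs L.γ L.ceS) (hi : Bv2sp L.timing L.τs L.γ L.inS)
    (hv : L.timing.Valid L.τs) (m : ℕ) :
    L.regS m (edge L.τs (m + 1)) = Level.ofBit (L.outS m) := by
  refine regS_new hs hi hv m _ ⟨?_, le_rfl⟩
  obtain ⟨h1, h2, h3, h4, h5⟩ := hv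
  rw [edge_succ]
  linarith

/-- Before the minimal propagation delay, or throughout if the register is not clocked, the sender
register still shows its previous content. -/
theorem regS_old (hs : Bv2sp L.timing L.τs L.γ L.ceS) (hi : Bv2sp L.timing L.τs L.γ L.inS)
    (hv : L.timing.Valid L.τs) (m : ℕ) {t : ℝ}
    (ht : t ∈ Set.Ioc (edge L.τs (m + 1)) (edge L.τs (m + 2)))
    (h : L.ceS m = false ∨ t ≤ edge L.τs (m + 1) + L.timing.tpmin) :
    L.regS (m + 1) t = Level.ofBit (L.outS m) := by
  rw [edge_succ L.τs (m + 1)] at ht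
  rw [regS_succ hs hi hv, regS_edge hs hi hv]
  cases hce : L.ceS m
  · simp [ht]
  · have : t ∈ Set.Ioc (edge L.τs (m + 1)) (edge L.τs (m + 1) + L.timing.tpmin) :=
      ⟨ht.1, h.resolve_left (by simp [hce])⟩
    simp [this]

theorem outS_hold {E : ℕ} (hce : ∀ j < 7, L.ceS (E + j) = false) {j : ℕ} (hj : j ≤ 7) :
    L.outS (E + j) = L.outS E := by
  induction j with
  | zero => rfl
  | succ j ih => rw [← add_assoc, outS, hce j (by omega), if_neg (by simp), ih (by omega)]

/-- A bit that is held for eight sender cycles is on the bus from the maximal propagation delay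
after its first edge to the minimal propagation delay after the first edge of the next bit. -/
theorem inR_eq (hL : L.WellFormed)
    (hin : ∀ m : ℕ, ∀ t ∈ Set.Ioc (edge L.τs m) (edge L.τs (m + 1)), L.inR t = L.regS m t)
    (hs : Bv2sp L.timing L.τs L.γ L.ceS) (hi : Bv2sp L.timing L.τs L.γ L.inS)
    {E : ℕ} (hce : ∀ j < 7, L.ceS (E + j) = false) {t : ℝ}
    (h1 : edge L.τs E + L.timing.tpmax < t) (h2 : t ≤ edge L.τs (E + 8) + L.timing.tpmin) :
    L.inR t = Level.ofBit (L.outS E) := by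
  obtain ⟨_, hτ, _, hv, _⟩ := hL
  obtain ⟨v1, v2, v3, v4, v5⟩ := id hv
  have hE0 : 0 ≤ edge L.τs E := mul_nonneg E.cast_nonneg hτ.le
  obtain ⟨m, hm⟩ := exists_cycle hτ (t := t) (by linarith)
  have hEm : E < m + 1 := lt_of_edge_lt hτ.le (by linarith [hm.2])
  have hm9 : m < E + 8 + 1 := by
    refine lt_of_edge_lt hτ.le ?_
    rw [edge_succ L.τs (E + 8)]
    linarith [hm.1]
  rw [hin m t hm]
  obtain ⟨j, rfl⟩ := Nat.exists_eq_add_of_le (Nat.lt_succ_iff.mp hEm)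
  rcases j with _ | j
  · exact regS_new hs hi hv E t ⟨h1, hm.2⟩
  · rw [← outS_hold hce (show j ≤ 7 by omega)]
    refine regS_old hs hi hv (E + j) hm ?_
    by_cases hj : j < 7
    · exact Or.inl (hce j hj)
    · obtain rfl : j = 7 := by omega
      exact Or.inr h2

/-! ### Sampling by the receiver -/

/-- An enabled receiver register whose input is stable around edge `k + 1` outputs the sampled bit
at the end of the cycle. -/
theorem regR_edge (hv : L.timing.Valid L.τr) (hceR : ∀ t, L.ceR t = Level.high) (k : ℕ) (b : Bool)
    (hst : ∀ t ∈ Set.Icc (edge L.τr (k + 1) - L.timing.ts) (edge L.τr (k + 1) + L.timing.th),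
      L.inR t = Level.ofBit b) :
    L.regR (k + 1) (edge L.τr (k + 2)) = Level.ofBit b := by
  obtain ⟨v1, v2, v3, v4, v5⟩ := hv
  have hmem : edge L.τr (k + 1) ∈
      Set.Icc (edge L.τr (k + 1) - L.timing.ts) (edge L.τr (k + 1) + L.timing.th) :=
    ⟨by linarith, by linarith⟩
  have hS : Stadep (edge L.τr (k + 1) - L.timing.ts) (edge L.τr (k + 1) + L.timing.th) L.ceR ∧
      Stadep (edge L.τr (k + 1) - L.timing.ts) (edge L.τr (k + 1) + L.timing.th) L.inR :=
    ⟨⟨true, fun t _ => hceR t⟩, ⟨b, hst⟩⟩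
  simp only [regR, analogReg]
  rw [if_pos hS, if_pos (hceR _), hst _ hmem, edge_succ L.τr (k + 1)]
  have n1 : edge L.τr (k + 1) + L.τr ∉
      Set.Ioc (edge L.τr (k + 1)) (edge L.τr (k + 1) + L.timing.tpmin) := fun h => by
    linarith [h.2]
  have n2 : edge L.τr (k + 1) + L.τr ∉ Set.Ioc (edge L.τr (k + 1) + L.timing.tpmin)
      (edge L.τr (k + 1) + L.timing.tpmax) := fun h => by linarith [h.2]
  have n3 : edge L.τr (k + 1) + L.τr ∈ Set.Ioc (edge L.τr (k + 1) + L.timing.tpmax)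
      (edge L.τr (k + 1) + L.τr) := ⟨by linarith, le_rfl⟩
  simp only [if_neg n1, if_neg n2, if_pos n3]

/-- Strictly between the mark of a bit and the mark of the next bit, the receiver reads the bit
correctly. At the mark itself the set-up window may overlap the propagation of the new bit. -/
theorem inp_eq (hL : L.WellFormed)
    (hin : (∀ m : ℕ, ∀ t ∈ Set.Ioc (edge L.τs m) (edge L.τs (m + 1)), L.inR t = L.regS m t) ∧
      ∀ t, L.ceR t = Level.high)
    (hs : Bv2sp L.timing L.τs L.γ L.ceS) (hi : Bv2sp L.timing L.τs L.γ L.inS)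
    {inp : ℕ → Bool} (hAD : L.MixAD inp)
    {E p q : ℕ} (hce : ∀ j < 7, L.ceS (E + j) = false)
    (hp : L.Mark p E) (hq : L.Mark q (E + 8)) {t : ℕ} (h1 : p < t) (h2 : t < q) :
    inp t = L.outS E := by
  obtain ⟨_, _, hτ, _, hv⟩ := id hL
  obtain ⟨v1, v2, v3, v4, v5⟩ := id hv
  obtain ⟨k, rfl⟩ : ∃ k, t = k + 1 := ⟨t - 1, by omega⟩
  have hd := hAD (k + 1)
  have e1 : edge L.τr p + L.τr ≤ edge L.τr (k + 1) := by
    rw [← edge_succ]; exact edge_mono hτ.le h1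
  have e2 : edge L.τr (k + 1) + L.τr ≤ edge L.τr q := by
    rw [← edge_succ]; exact edge_mono hτ.le h2
  rw [Digitizes, regR_edge hv hin.2 k (L.outS E) (fun t ht =>
    inR_eq hL hin.1 hs hi hce (by linarith [ht.1, hp.1]) (by linarith [ht.2, hq.2]))] at hd
  cases h : L.outS E <;> simpa [h, Level.ofBit] using hd

end Link

/-! ### The majority vote -/

section Receiver

variable {l : ℕ} {inp : ℕ → Bool} {r : ℕ → Recv}

theorem v_add_six (hrun : IsRun l inp r) (t : ℕ) :
    (r (t + 6)).v = decide (3 ≤ (inp (t + 4)).toNat + (inp (t + 3)).toNat + (inp (t + 2)).toNat +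
      (inp (t + 1)).toNat + (inp t).toNat) := by
  simp only [Recv.v, hrun (t + 5), hrun (t + 4), hrun (t + 3), hrun (t + 2), hrun (t + 1), hrun t,
    Recv.step]
  rfl

/-- If all inputs strictly between `p` and `q` agree, so do the voted bits from `p + 5` to `q + 3`:
three of the five bits voted on lie in this range. -/
theorem v_eq_of_const (hrun : IsRun l inp r) {p q : ℕ} {b : Bool} (hp : 0 < p) (hpq : p + 3 < q)
    (hb : ∀ t, p < t → t < q → inp t = b) {t : ℕ} (h1 : p + 5 ≤ t) (h2 : t ≤ q + 3) :
    (r t).v = b := by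
  obtain ⟨u, rfl⟩ : ∃ u, t = u + 6 := ⟨t - 6, by omega⟩
  rw [v_add_six hrun]
  rcases (by omega : u + 4 < q ∨ u + 4 = q ∨ u + 4 = q + 1) with h | h | h
  · rw [hb (u + 4) (by omega) (by omega), hb (u + 3) (by omega) (by omega),
      hb (u + 2) (by omega) (by omega)]
    cases b <;> cases inp (u + 1) <;> cases inp u <;> rfl
  · rw [hb (u + 1) (by omega) (by omega), hb (u + 3) (by omega) (by omega),
      hb (u + 2) (by omega) (by omega)]
    cases b <;> cases inp (u + 4) <;> cases inp u <;> rfl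
  · rw [hb (u + 1) (by omega) (by omega), hb u (by omega) (by omega),
      hb (u + 2) (by omega) (by omega)]
    cases b <;> cases inp (u + 4) <;> cases inp (u + 3) <;> rfl

/-- Whatever the next inputs are, the voted bit of an idle receiver stays one for three cycles. -/
theorem Recv.Idle.v_eq_true (hrun : IsRun l inp r) {m : ℕ} (h : (r m).Idle) {k : ℕ} (hk : k ≤ 3) :
    (r (m + k)).v = true := by
  obtain ⟨-, hR, hRH, hSH, -⟩ := h
  have h0 := hSH 0
  have h1 := hSH 1
  have h2 := hSH 2
  have h3 := hSH 3
  obtain rfl | rfl | rfl | rfl : k = 0 ∨ k = 1 ∨ k = 2 ∨ k = 3 := by omega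
  · simp [Recv.v, hRH, h0, h1, h2, h3]
  · simp [Recv.v, hrun m, Recv.step, hR, hRH, h0, h1, h2]
  · simp [Recv.v, hrun (m + 1), hrun m, Recv.step, hR, hRH, h0, h1]
  · simp [Recv.v, hrun (m + 2), hrun (m + 1), hrun m, Recv.step, hR, hRH, h0]

/-! ### Counter and control automaton -/

theorem vOld_succ (hrun : IsRun l inp r) (t : ℕ) : (r (t + 1)).vOld = (r t).v := by
  rw [hrun t]; rfl

theorem sync_eq_false_of_v {s : Recv} (h : s.v = s.vOld) : s.sync = false := by
  simp [Recv.sync, h]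

theorem sync_eq_false_of_z {s : Recv} (h1 : s.z ≠ CtrlState.bss1) (h2 : s.z ≠ CtrlState.idle) :
    s.sync = false := by
  simp [Recv.sync, h1, h2]

/-- After a strobe (when the counter is `3`) and without synchronization, control state and data
registers are unchanged for seven cycles, in which the counter runs up to its strobe value. The
absence of synchronization has to be checked only in the unchanged control state. -/
theorem hold (hrun : IsRun l inp r) {t k : ℕ} (hz : (r t).z ≠ CtrlState.idle)
    (hcnt : (r t).cnt = 3#3) (hk : k ≤ 7)
    (hns : ∀ j < k, (r (t + j)).z = (r t).z → (r (t + j)).sync = false) :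
    (r (t + k)).z = (r t).z ∧ (r (t + k)).cnt = 3#3 + BitVec.ofNat 3 k ∧
      (r (t + k)).nb = (r t).nb ∧ (r (t + k)).BYTE = (r t).BYTE := by
  induction k with
  | zero => simp [hcnt]
  | succ k ih =>
    obtain ⟨i1, i2, i3, i4⟩ := ih (by omega) fun j hj => hns j (by omega)
    have hsy := hns k (by omega) i1
    have hst : (r (t + k)).strobe = false := by
      have : (3#3 + BitVec.ofNat 3 k) ≠ 2#3 := by
        have : k < 7 := by omega
        interval_cases k <;> decide
      simp [Recv.strobe, i2, this]
    have hc : 3#3 + BitVec.ofNat 3 k + 1#3 = 3#3 + BitVec.ofNat 3 (k + 1) := by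
      have : k < 7 := by omega
      interval_cases k <;> decide
    rw [← add_assoc, hrun (t + k)]
    simp [Recv.step, hst, hsy, i1, i2, i3, i4, hz, Recv.we, hc]

theorem strobe_succ (hrun : IsRun l inp r) {t : ℕ} (hcnt : (r t).cnt = 2#3)
    (hsy : (r t).sync = false) :
    (r (t + 1)).z = (r t).nextCtrl l ∧ (r (t + 1)).cnt = 3#3 ∧
      (r (t + 1)).nb = (if (r t).z = CtrlState.idle then 0
        else if (r t).z = CtrlState.b 7 then (r t).nb + 1 else (r t).nb) ∧
      (r (t + 1)).BYTE = fun j => if j = 7 then (r t).v else (r t).BYTE (j + 1) := by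
  have hst : (r t).strobe = true := by simp [Recv.strobe, hcnt, hsy]
  rw [hrun t]
  simp [Recv.step, hst, hsy, hcnt, Recv.we]

/-- In a state in which the receiver does not synchronize, a strobe is followed by the next one
eight cycles later. -/
theorem block (hrun : IsRun l inp r) {t : ℕ} (hz0 : (r t).z ≠ CtrlState.idle)
    (hz1 : (r t).z ≠ CtrlState.bss1) (hcnt : (r t).cnt = 3#3) :
    ((r (t + 7)).z = (r t).z ∧ (r (t + 7)).cnt = 2#3) ∧
      (r (t + 8)).z = (r (t + 7)).nextCtrl l ∧ (r (t + 8)).cnt = 3#3 ∧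
      (r (t + 7)).nb = (r t).nb ∧
      (r (t + 8)).nb = (if (r t).z = CtrlState.b 7 then (r t).nb + 1 else (r t).nb) ∧
      (r (t + 8)).BYTE = fun j => if j = 7 then (r (t + 7)).v else (r t).BYTE (j + 1) := by
  obtain ⟨i1, i2, i3, i4⟩ := hold hrun hz0 hcnt (le_refl 7) fun j _ h =>
    sync_eq_false_of_z (h ▸ hz1) (h ▸ hz0)
  have hsy : (r (t + 7)).sync = false := sync_eq_false_of_z (i1 ▸ hz1) (i1 ▸ hz0)
  obtain ⟨s1, s2, s3, s4⟩ := strobe_succ hrun i2 hsy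
  refine ⟨⟨i1, i2⟩, s1, s2, i3, ?_, ?_⟩
  · rw [s3, i1, i3, if_neg hz0]
  · rw [s4, i4]

/-- An idle receiver that votes ones stays idle. -/
theorem idle_hold (hrun : IsRun l inp r) {t k : ℕ} (hz : (r t).z = CtrlState.idle)
    (hv : ∀ j < k, (r (t + j)).v = true) : (r (t + k)).z = CtrlState.idle := by
  induction k with
  | zero => exact hz
  | succ k ih =>
    have i := ih fun j hj => hv j (by omega)
    rw [← add_assoc, hrun (t + k)]
    simp [Recv.step, i, Recv.nextCtrl, hv k (by omega)]

/-- The zero that caused a synchronization in cycle `s` is strobed in cycle `s + 3`; it moves the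
automaton from `idle` to `fss` or from `bss1` to `b 0`. -/
theorem strobe_of_sync (hrun : IsRun l inp r) {s : ℕ} (hsy : (r s).sync = true)
    (hv : ∀ j ≤ 3, (r (s + j)).v = false) :
    (r (s + 4)).cnt = 3#3 ∧
    ((r s).z = CtrlState.idle → (r (s + 4)).z = CtrlState.fss ∧ (r (s + 4)).nb = 0) ∧
    ((r s).z = CtrlState.bss1 → (r (s + 4)).z = CtrlState.b 0 ∧ (r (s + 4)).nb = (r s).nb) := by
  have hz : (r s).z = CtrlState.bss1 ∨ (r s).z = CtrlState.idle := by
    simp only [Recv.sync, decide_eq_true_eq] at hsy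
    exact hsy.2
  have q (j : ℕ) (hj : j < 3) : (r (s + j + 1)).sync = false :=
    sync_eq_false_of_v (by rw [vOld_succ hrun, hv j (by omega), add_assoc, hv _ (by omega)])
  have nb0 {t : ℕ} (hst : (r t).strobe = false) : (r (t + 1)).nb =
      if (r t).z = CtrlState.idle then 0 else (r t).nb := by
    rw [hrun t]; simp [Recv.step, Recv.we, hst]
  have zst {t : ℕ} (hst : (r t).strobe = false) : (r (t + 1)).z = (r t).z := by
    rw [hrun t]; simp [Recv.step, hst]
  have cst {t : ℕ} (h : (r t).sync = false) : (r (t + 1)).cnt = (r t).cnt + 1 := by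
    rw [hrun t]; simp [Recv.step, h]
  have st0 : (r s).strobe = false := by simp [Recv.strobe, hsy]
  have c1 : (r (s + 1)).cnt = 0#3 := by rw [hrun s]; simp [Recv.step, hsy]
  have st1 : (r (s + 1)).strobe = false := by simp [Recv.strobe, c1]
  have c2 : (r (s + 2)).cnt = 1#3 := by rw [cst (q 0 (by omega))]; simp [c1]
  have st2 : (r (s + 2)).strobe = false := by simp [Recv.strobe, c2]
  have c3 : (r (s + 3)).cnt = 2#3 := by rw [cst (q 1 (by omega)), c2]; rfl
  obtain ⟨s1, s2, s3, -⟩ := strobe_succ hrun c3 (q 2 (by omega))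
  have z3 : (r (s + 3)).z = (r s).z := by rw [zst st2, zst st1, zst st0]
  have z2 : (r (s + 2)).z = (r s).z := by rw [zst st1, zst st0]
  have z1 : (r (s + 1)).z = (r s).z := zst st0
  refine ⟨s2, fun h => ⟨?_, ?_⟩, fun h => ⟨?_, ?_⟩⟩
  · rw [s1, Recv.nextCtrl, z3, h]
    simp [hv 3 le_rfl]
  · rw [s3, z3, h, if_pos rfl]
  · rw [s1, Recv.nextCtrl, z3, h]
  · rw [s3, z3, h, if_neg (by simp), if_neg (by simp), nb0 st2, z2, h, if_neg (by simp), nb0 st1,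
      z1, h, if_neg (by simp), nb0 st0, h, if_neg (by simp)]

/-- When the voted bit falls in one of the cycles `m + 4` and `m + 5`, a synchronizing state that
lasts until then sees the edge there. -/
theorem exists_sync (hrun : IsRun l inp r) {m : ℕ} {Z : CtrlState}
    (hZ : Z = CtrlState.bss1 ∨ Z = CtrlState.idle)
    (hz4 : (r (m + 4)).z = Z) (hz5 : (r (m + 4)).v = true → (r (m + 5)).z = Z)
    (hv3 : (r (m + 3)).v = true) (hv5 : (r (m + 5)).v = false) :
    ∃ s, (s = m + 4 ∨ s = m + 5) ∧ (r s).sync = true ∧ (r s).z = Z ∧ (r s).v = false := by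
  cases h : (r (m + 4)).v
  · exact ⟨m + 4, Or.inl rfl, by simp [Recv.sync, h, vOld_succ hrun, hv3, hz4, hZ], hz4, h⟩
  · exact ⟨m + 5, Or.inr rfl, by simp [Recv.sync, h, vOld_succ hrun, hv5, hz5 h, hZ], hz5 h, hv5⟩

/-- The idle receiver synchronizes to the transmission start bit in one of the cycles `m + 4` and
`m + 5`; the third strobe after that takes it to `bss1`. -/
theorem bss1_of_idle (hrun : IsRun l inp r) {m : ℕ} (hidle : (r m).Idle)
    (hv : ∀ t, m + 5 ≤ t → t ≤ m + 8 → (r t).v = false) :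
    ∃ T, (T = m + 24 ∨ T = m + 25) ∧ (r T).z = CtrlState.bss1 ∧ (r T).cnt = 3#3 ∧
      (r T).nb = 0 := by
  have hv3 {k : ℕ} (hk : k ≤ 3) := hidle.v_eq_true hrun hk
  have hz4 : (r (m + 4)).z = CtrlState.idle :=
    idle_hold hrun hidle.1 fun j hj => hv3 (by omega)
  obtain ⟨s, hs, hsy, hsz, hsv⟩ := exists_sync hrun (Or.inr rfl) hz4
    (fun h => idle_hold (k := 1) hrun hz4 fun j hj => by
      obtain rfl : j = 0 := by omega
      exact h)
    (hv3 le_rfl) (hv _ le_rfl (by omega))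
  obtain ⟨a1, a2, -⟩ := strobe_of_sync hrun hsy fun j hj => by
    rcases j with _ | j
    · exact hsv
    · exact hv _ (by omega) (by omega)
  obtain ⟨a2, a3⟩ := a2 hsz
  obtain ⟨⟨b1, -⟩, b2, b3, -, b4, -⟩ := block hrun (by simp [a2]) (by simp [a2]) a1
  rw [Recv.nextCtrl, b1, a2] at b2
  obtain ⟨⟨c1, -⟩, c2, c3, -, c4, -⟩ := block hrun (by simp [b2]) (by simp [b2]) b3
  rw [Recv.nextCtrl, c1, b2] at c2
  refine ⟨s + 4 + 8 + 8, by omega, c2, c3, ?_⟩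
  rw [c4, b4, b2, a2, a3]
  simp

/-- In state `bss1` the receiver synchronizes to the falling edge of the byte start sequence,
provided that edge appears before the next strobe is due. -/
theorem b_zero_of_bss1 (hrun : IsRun l inp r) {m T : ℕ} (hz : (r T).z = CtrlState.bss1)
    (hcnt : (r T).cnt = 3#3) (h1 : m ≤ T + 1) (h2 : T ≤ m + 2)
    (hv1 : ∀ t, m ≤ t + 2 → t ≤ m + 3 → (r t).v = true)
    (hv0 : ∀ t, m + 5 ≤ t → t ≤ m + 8 → (r t).v = false) (hT : 0 < T) :
    ∃ u, (u = m + 8 ∨ u = m + 9) ∧ (r u).z = CtrlState.b 0 ∧ (r u).cnt = 3#3 ∧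
      (r u).nb = (r T).nb := by
  obtain ⟨T', rfl⟩ : ∃ T', T = T' + 1 := ⟨T - 1, by omega⟩
  have key {k : ℕ} (hk : k ≤ 7) (hv : ∀ j < k, (r (T' + 1 + j)).v = true) :=
    hold hrun (t := T' + 1) (k := k) (by simp [hz]) hcnt hk fun j hj _ =>
      sync_eq_false_of_v <| by
        rw [hv j hj, show T' + 1 + j = T' + j + 1 by omega, vOld_succ hrun]
        rcases j with _ | j
        · exact (hv1 _ (by omega) (by omega)).symm
        · rw [← hv j (by omega)]; congr 2; omega
  obtain ⟨d, hd⟩ : ∃ d, m + 4 = T' + 1 + d := ⟨m + 4 - (T' + 1), by omega⟩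
  have hv4 : ∀ j < d, (r (T' + 1 + j)).v = true := fun j hj => hv1 _ (by omega) (by omega)
  obtain ⟨k1, -, k3, -⟩ := key (by omega) hv4
  have hk5 (h : (r (m + 4)).v = true) := key (k := d + 1) (by omega) fun j hj => by
    rcases Nat.lt_succ_iff_lt_or_eq.mp hj with hj | rfl
    · exact hv4 j hj
    · rwa [← hd]
  rw [← add_assoc, ← hd] at hk5
  rw [← hd] at k1 k3
  obtain ⟨s, hs, hsy, hsz, hsv⟩ := exists_sync hrun (Or.inl rfl) (k1.trans hz)
    (fun h => (hk5 h).1.trans hz) (hv1 _ (by omega) le_rfl) (hv0 _ le_rfl (by omega))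
  have hnb : (r s).nb = (r (T' + 1)).nb := by
    rcases hs with rfl | rfl
    · exact k3
    · refine (hk5 ?_).2.2.1
      by_contra hne
      -- the voted bits of cycles `m + 4` and `m + 5` agree, so there is no edge between them
      rw [Bool.not_eq_true] at hne
      rw [sync_eq_false_of_v (by rw [vOld_succ hrun, hne, hsv])] at hsy
      simp at hsy
  obtain ⟨a1, -, a2⟩ := strobe_of_sync hrun hsy fun j hj => by
    rcases j with _ | j
    · exact hsv
    · exact hv0 _ (by omega) (by omega)
  obtain ⟨a2, a3⟩ := a2 hsz
  exact ⟨s + 4, by omega, a2, a1, a3.trans hnb⟩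

/-- While a byte is received, its bits are strobed every eight cycles and shifted into `BYTE`. -/
theorem byte_prefix (hrun : IsRun l inp r) {u : ℕ} (hz : (r u).z = CtrlState.b 0)
    (hcnt : (r u).cnt = 3#3) (k : Fin 8) :
    (r (u + 8 * k)).z = CtrlState.b k ∧ (r (u + 8 * k)).cnt = 3#3 ∧
      (r (u + 8 * k)).nb = (r u).nb ∧
      ∀ j : Fin 8, 8 ≤ (j : ℕ) + k →
        (r (u + 8 * k)).BYTE j = (r (u + 8 * ((j : ℕ) + k - 8) + 7)).v := by
  induction k using Fin.induction with
  | zero => exact ⟨hz, hcnt, rfl, fun j hj => absurd j.2 (not_lt.mpr hj)⟩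
  | succ k ih =>
    obtain ⟨i1, i2, i3, i4⟩ := ih
    obtain ⟨⟨b1, -⟩, b2, b3, -, b4, b5⟩ := block hrun (by rw [i1]; simp) (by rw [i1]; simp) i2
    have hk7 : k.castSucc ≠ 7 := fun h => by
      have := congrArg Fin.val h
      simp at this
      omega
    have e : u + 8 * (k.succ : ℕ) = u + 8 * (k.castSucc : ℕ) + 8 := by simp; ring
    rw [Recv.nextCtrl, b1, i1] at b2
    rw [i1, if_neg (by simpa using hk7), i3] at b4
    rw [e]
    refine ⟨?_, b3, b4, fun j hj => ?_⟩
    · rw [b2]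
      simp [hk7, Fin.coeSucc_eq_succ]
    · rw [b5]
      by_cases hj7 : j = 7
      · subst hj7
        simp only [↓reduceIte]
        congr 2
        simp only [Fin.val_succ, Fin.val_castSucc, show ((7 : Fin 8) : ℕ) = 7 from rfl]
        omega
      · have hj' : ((j + 1 : Fin 8) : ℕ) = j + 1 := by
          rw [Fin.val_add_one, if_neg (by simpa using hj7)]
        simp only [if_neg hj7]
        simp only [Fin.val_succ] at hj
        rw [i4 _ (by rw [hj']; simp only [Fin.val_castSucc]; omega), hj']
        congr 2
        simp only [Fin.val_succ, Fin.val_castSucc]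
        omega

/-- A receiver that enters `b 0` in cycle `u` completes the byte in cycle `u + 63`; if it is not the
last one of the message, the automaton is in state `bss1` again in cycle `u + 72`. -/
theorem byte_received (hrun : IsRun l inp r) {u : ℕ} (hz : (r u).z = CtrlState.b 0)
    (hcnt : (r u).cnt = 3#3) :
    ByteReceived r (u + 63) (fun j => (r (u + 8 * (j : ℕ) + 7)).v) ∧
      ((r u).nb + 1 < l → (r (u + 72)).z = CtrlState.bss1 ∧ (r (u + 72)).cnt = 3#3 ∧
        (r (u + 72)).nb = (r u).nb + 1) := by
  obtain ⟨i1, i2, i3, i4⟩ := byte_prefix hrun hz hcnt 7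
  have e7 : u + 8 * ((7 : Fin 8) : ℕ) = u + 56 := rfl
  rw [e7] at i1 i2 i3 i4
  obtain ⟨⟨b1, b1'⟩, b2, b3, b3', b4, b5⟩ := block hrun (by simp [i1]) (by simp [i1]) i2
  refine ⟨⟨b1.trans i1, b1', ?_⟩, fun h => ?_⟩
  · rw [b5]
    funext j
    by_cases hj7 : j = 7
    · subst hj7
      simp
    · have hj' : ((j + 1 : Fin 8) : ℕ) = j + 1 := by
        rw [Fin.val_add_one, if_neg (by simpa using hj7)]
      simp only [if_neg hj7]
      rw [i4 _ (by rw [hj']; show 8 ≤ (j : ℕ) + 1 + 7; omega), hj']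
      rfl
  · rw [i1, if_pos rfl, i3] at b4
    rw [Recv.nextCtrl, b1, i1] at b2
    simp only [if_true, b3', i3, if_pos h] at b2
    obtain ⟨⟨c1, -⟩, c2, c3, -, c4, -⟩ := block hrun (by simp [b2]) (by simp [b2]) b3
    rw [Recv.nextCtrl, c1, b2] at c2
    refine ⟨c2, c3, ?_⟩
    rw [show u + 72 = u + 56 + 8 + 8 from rfl, c4, b2, b4]
    simp

end Receiver

end FlexRay

/-! ### Transmission of a frame -/

theorem theorem1 (L : Link) (l ξ c : ℕ) (inp : ℕ → Bool) (r : ℕ → Recv)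
    (hL : L.WellFormed)
    (hH : L.HypH 7 6 ξ c)
    (hπ : (80 : ℝ) ≤ driftBound L.δ)
    (hAD : L.MixAD inp)
    (hce : WFce L.ceS (10 * l + 2) 7 c)
    (hTss : WFTss L.outS c)
    (hIn : WFIn L.outS l c)
    (hrun : IsRun l inp r)
    (hidle : (r ξ).Idle) :
    ∀ i < l, ∃ ν : ℕ,
      L.Mark ν (c + 16 + 80 * i) ∧
      ((L.Mark (ν + 7) (c + 24 + 80 * i) ∧
          ByteReceived r (ν + 78)
            (fun j => L.outS (c + 16 + 80 * i + 8 * ((j : ℕ) + 2)))) ∨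
        ((L.Mark (ν + 7) (c + 24 + 80 * i) ∨ L.Mark (ν + 8) (c + 24 + 80 * i)) ∧
          ByteReceived r (ν + 79)
            (fun j => L.outS (c + 16 + 80 * i + 8 * ((j : ℕ) + 2)))) ∨
        ((L.Mark (ν + 8) (c + 24 + 80 * i) ∨ L.Mark (ν + 9) (c + 24 + 80 * i)) ∧
          ByteReceived r (ν + 80)
            (fun j => L.outS (c + 16 + 80 * i + 8 * ((j : ℕ) + 2)))) ∨
        (L.Mark (ν + 9) (c + 24 + 80 * i) ∧
          ByteReceived r (ν + 81)
            (fun j => L.outS (c + 16 + 80 * i + 8 * ((j : ℕ) + 2))))) := by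
  obtain ⟨⟨hjr, hjs, -, -, hξ⟩, hlink, ⟨hs, hi⟩, hc, -⟩ := hH
  have hd := drift_le hL.1 hπ hjs hjr
  have hr0 := hL.2.2.1
  have hξ0 := hξ.pos hL hc
  have mk (n : ℕ) := hξ.exists_later hL n
  have hle {p n : ℕ} (hp : L.Mark p (c + n)) : ξ ≤ p := by
    by_contra h
    have h1 := edge_succ L.τr p ▸ edge_mono hr0.le (show p + 1 ≤ ξ by omega)
    have h2 := edge_mono hL.2.1.le (Nat.le_add_right c n)
    linarith [hp.1, hξ.2]
  -- the voted bits show frame bit `i` from five cycles after its mark to three cycles after the next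
  have hbit {i p q E : ℕ} (hil : i < 10 * l + 2) (hE : E = c + 8 * i) (hp : L.Mark p E)
      (hq : L.Mark q (E + 8)) {t : ℕ} (h1 : p + 5 ≤ t) (h2 : t ≤ q + 3) :
      (r t).v = L.outS E := by
    have hdist := hp.dist hr0 hd (by norm_num) hq
    have hp0 := hle (hE ▸ hp)
    refine v_eq_of_const hrun (by omega) (by omega) (fun t h1 h2 => ?_) h1 h2
    refine Link.inp_eq hL hlink hs hi hAD (fun j hj => ?_) hp hq h1 h2
    rw [hE]
    exact (hce i hil).2 (j + 1) (Finset.mem_Icc.mpr ⟨by omega, by omega⟩)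
  have enter {i μ T : ℕ} (hil : i < l) (hμ : L.Mark μ (c + 24 + 80 * i)) (h1 : μ ≤ T + 1)
      (h2 : T ≤ μ + 2) (hz : (r T).z = CtrlState.bss1) (hcnt : (r T).cnt = 3#3)
      (hnb : (r T).nb = i) :
      ∃ u, (u = μ + 8 ∨ u = μ + 9) ∧ (r u).z = CtrlState.b 0 ∧ (r u).cnt = 3#3 ∧
        (r u).nb = i := by
    obtain ⟨ν, hν⟩ := mk (16 + 80 * i)
    rw [← add_assoc] at hν
    have hμ' : L.Mark μ (c + 16 + 80 * i + 8) := by convert hμ using 1; ring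
    obtain ⟨σ, hσ⟩ := mk (32 + 80 * i)
    have hσ' : L.Mark σ (c + 24 + 80 * i + 8) := by convert hσ using 1; ring
    have d1 := hν.dist hr0 hd (by norm_num) hμ'
    have d2 := hμ.dist hr0 hd (by norm_num) hσ'
    obtain ⟨b1, b0⟩ := hIn i hil 0 (by simp)
    simp only [add_zero, add_right_comm c (80 * i)] at b1 b0
    subst hnb
    refine b_zero_of_bss1 hrun hz hcnt h1 h2 (fun t t1 t2 => ?_) (fun t t1 t2 => ?_) (by omega)
    · rw [← b1]
      exact hbit (i := 10 * (r T).nb + 2) (by omega) (by ring) hν hμ' (by omega) (by omega)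
    · rw [← b0]
      exact hbit (i := 10 * (r T).nb + 3) (by omega) (by ring) hμ hσ' (by omega) (by omega)
  -- resynchronization at every byte start sequence keeps the drift from accumulating over bytes
  have inv (i : ℕ) : i < l → ∀ μ, L.Mark μ (c + 24 + 80 * i) →
      ∃ T, μ ≤ T + 1 ∧ T ≤ μ + 2 ∧ (r T).z = CtrlState.bss1 ∧ (r T).cnt = 3#3 ∧ (r T).nb = i := by
    induction i with
    | zero =>
      intro hl μ hμ
      have hμ' : L.Mark μ (c + 24) := hμ
      have d := hξ.dist hr0 hd (by norm_num) hμ'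
      obtain ⟨σ, hσ⟩ := mk 8
      have dσ := hξ.dist hr0 hd (by norm_num) hσ
      obtain ⟨T, hT, h⟩ := bss1_of_idle hrun hidle fun t t1 t2 => by
        rw [← hTss 0 (by simp)]
        exact hbit (i := 0) (by omega) (by ring) hξ hσ (by omega) (by omega)
      exact ⟨T, by omega, by omega, h⟩
    | succ i ih =>
      intro hl μ' hμ'
      obtain ⟨μ, hμ⟩ := mk (24 + 80 * i)
      rw [← add_assoc] at hμ
      obtain ⟨T, h1, h2, hz, hcnt, hnb⟩ := ih (by omega) μ hμ
      obtain ⟨u, hu, uz, uc, un⟩ := enter (by omega) hμ h1 h2 hz hcnt hnb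
      have d := hμ.dist (n := 80) hr0 hd le_rfl (by convert hμ' using 1; ring)
      obtain ⟨z, k, nb⟩ := (byte_received hrun uz uc).2 (by omega)
      exact ⟨u + 72, by omega, by omega, z, k, nb.trans (by rw [un])⟩
  intro i hil
  obtain ⟨ν, hν⟩ := mk (16 + 80 * i)
  obtain ⟨μ, hμ⟩ := mk (24 + 80 * i)
  rw [← add_assoc] at hν hμ
  obtain ⟨T, h1, h2, hz, hcnt, hnb⟩ := inv i hil μ hμ
  obtain ⟨u, hu, uz, uc, -⟩ := enter hil hμ h1 h2 hz hcnt hnb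
  have d := hν.dist (n := 8) hr0 hd (by norm_num) (by convert hμ using 1; ring)
  have hbyte : ByteReceived r (u + 63)
      (fun j => L.outS (c + 16 + 80 * i + 8 * ((j : ℕ) + 2))) := by
    convert (byte_received hrun uz uc).1 using 1
    funext j
    have hj := j.2
    obtain ⟨p, hp⟩ := mk (16 + 80 * i + 8 * ((j : ℕ) + 2))
    obtain ⟨q, hq⟩ := mk (16 + 80 * i + 8 * ((j : ℕ) + 2) + 8)
    rw [← add_assoc, ← add_assoc] at hp
    rw [← add_assoc, ← add_assoc, ← add_assoc] at hq
    have dp := hμ.dist (n := 8 * ((j : ℕ) + 1)) hr0 hd (by omega) (by convert hp using 1; ring)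
    have dq := hμ.dist (n := 8 * ((j : ℕ) + 2)) hr0 hd (by omega) (by convert hq using 1; ring)
    exact (hbit (i := 10 * i + j + 4) (by omega) (by ring) hp hq (by omega) (by omega)).symm
  obtain h | h | h : μ = ν + 7 ∨ μ = ν + 8 ∨ μ = ν + 9 := by omega
  all_goals
    subst h
    refine ⟨ν, hν, ?_⟩
    rcases hu with rfl | rfl
  · exact Or.inl ⟨hμ, hbyte⟩
  · exact Or.inr (Or.inl ⟨Or.inl hμ, hbyte⟩)
  · exact Or.inr (Or.inl ⟨Or.inr hμ, hbyte⟩)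
  · exact Or.inr (Or.inr (Or.inl ⟨Or.inl hμ, hbyte⟩))
  · exact Or.inr (Or.inr (Or.inl ⟨Or.inr hμ, hbyte⟩))
  · exact Or.inr (Or.inr (Or.inr ⟨hμ, hbyte⟩))
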